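/- Let $\tau$ be in the upper half-plane, let $z\in\mathbb{C}$ with $z\notin\mathbb{Z}+\mathbb{Z}\tau$, and put $q=e^{2\pi i\tau}$, $y=e^{2\pi i z}$, $q^{1/8}=e^{2\pi i\tau/8}$, $q^{1/24}=e^{2\pi i\tau/24}$, $y^{\pm1/2}=e^{\pm\pi i z}$. Define $$\theta_1(\tau,z)= i\,q^{1/8}y^{-1/2}\prod_{n=1}^\infty(1-q^n)(1-q^{n-1}y)(1-q^n y^{-1}),\qquad \eta(\tau)=q^{1/24}\prod_{n=1}^\infty(1-q^n),$$ $$\mu(\tau,z)=\frac{-i\,y^{1/2}}{\theta_1(\tau,z)}\sum_{\ell\in\mathbb{Z}}\frac{(-1)^\ell y^\ell q^{\ell(\ell+1)/2}}{1-y\,q^\ell},\qquad F_2^{(2)}(\tau)=\sum_{\substack{r>s>0\\ r-s\ \mathrm{odd}}}(-1)^r\,s\,q^{rs/2},$$ where $r,s$ are integers, and $$s_1(\tau,z)=\frac{\theta_1(\tau,z)}{\eta(\tau)^3}\sum_{i\in\mathbb{Z}}\frac{1}{(1-y\,q^i)(1-y^{-1}q^{-i})}.$$ Then the product for $\theta_1(\tau,z)$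 converges and $\theta_1(\tau,z)\neq0$, the series defining $s_1$, $\mu$ and $F_2^{(2)}$ converge absolutely, and $$s_1(\tau,z)=\frac{\theta_1(\tau,z)}{\eta(\tau)^3}\,2F_2^{(2)}(\tau)+\theta_1(\tau,z)\,\mu(\tau,z).$$ -/

import Mathlib

noncomputable section

namespace HodgeElliptic

open Complex UpperHalfPlane

/-- The nome `q = e^{2πiτ}`. -/
def q (τ : ℍ) : ℂ := cexp (2 * Real.pi * Complex.I * (τ : ℂ))

/-- The elliptic variable `y = e^{2πiz}`. -/
def y (z : ℂ) : ℂ := cexp (2 * Real.pi * Complex.I * z)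

/-- The factor of index `n + 1` in the product for `θ₁`:
`(1 - q^{n+1}) (1 - q^n y) (1 - q^{n+1} y⁻¹)`, for `n = 0, 1, 2, …`. -/
def thetaFactor (τ : ℍ) (z : ℂ) (n : ℕ) : ℂ :=
  (1 - q τ ^ (n + 1)) * (1 - q τ ^ n * y z) * (1 - q τ ^ (n + 1) * (y z)⁻¹)

/-- `θ₁(τ,z) = i q^{1/8} y^{-1/2} ∏_{n ≥ 1} (1 - qⁿ)(1 - q^{n-1} y)(1 - qⁿ y⁻¹)`, where
`q^{1/8} = e^{2πiτ/8}` and `y^{-1/2} = e^{-πiz}`. -/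
def theta1 (τ : ℍ) (z : ℂ) : ℂ :=
  Complex.I * cexp (2 * Real.pi * Complex.I * (τ : ℂ) / 8) * cexp (-(Real.pi * Complex.I * z)) *
    ∏' n : ℕ, thetaFactor τ z n

/-- The `ℓ`-th term of the Appell–Lerch sum. The product `ℓ (ℓ + 1)` is even, so the integer
division by `2` is exact. -/
def appellLerchTerm (τ : ℍ) (z : ℂ) (l : ℤ) : ℂ :=
  (-1) ^ l * y z ^ l * q τ ^ (l * (l + 1) / 2) / (1 - y z * q τ ^ l)

/-- The Appell–Lerch sum
`μ(τ,z) = (-i y^{1/2} / θ₁(τ,z)) ∑_{ℓ ∈ ℤ} (-1)^ℓ y^ℓ q^{ℓ(ℓ+1)/2} / (1 - y q^ℓ)`, where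
`y^{1/2} = e^{πiz}`. -/
def mu (τ : ℍ) (z : ℂ) : ℂ :=
  -Complex.I * cexp (Real.pi * Complex.I * z) / theta1 τ z * ∑' l : ℤ, appellLerchTerm τ z l

/-- Pairs `(r, s)` of natural numbers with `r > s > 0` and `r - s` odd. -/
def OddGapPair : Type :=
  {p : ℕ × ℕ // 0 < p.2 ∧ p.2 < p.1 ∧ Odd (p.1 - p.2)}

/-- The term `(-1)^r s q^{rs/2}`. One of `r`, `s` is even, so the division by `2` is exact. -/
def f22Term (τ : ℍ) (p : OddGapPair) : ℂ :=
  (-1) ^ p.1.1 * (p.1.2 : ℂ) * q τ ^ (p.1.1 * p.1.2 / 2)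

/-- `F₂⁽²⁾(τ) = ∑_{r > s > 0, r - s odd} (-1)^r s q^{rs/2} = q + q² - q³ + q⁴ - ⋯`. -/
def F22 (τ : ℍ) : ℂ := ∑' p : OddGapPair, f22Term τ p

/-- The `i`-th term `1 / ((1 - y q^i) (1 - y⁻¹ q^{N-1-i}))` of the series for `s_N`. -/
def sTerm (N : ℤ) (τ : ℍ) (z : ℂ) (i : ℤ) : ℂ :=
  1 / ((1 - y z * q τ ^ i) * (1 - (y z)⁻¹ * q τ ^ (N - 1 - i)))

/-- `s_N(τ,z) = (θ₁(τ,z) / η(τ)³) ∑_{i ∈ ℤ} 1 / ((1 - y q^i) (1 - y⁻¹ q^{N-1-i}))`, with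
Mathlib's Dedekind eta function. -/
def s (N : ℤ) (τ : ℍ) (z : ℂ) : ℂ :=
  theta1 τ z / ModularForm.eta (τ : ℂ) ^ 3 * ∑' i : ℤ, sTerm N τ z i

end HodgeElliptic

end

/-! Write `θ_k = (-1)^k q^{k(k-1)/2}` and `Θ(y) = ∑ θ_k y^k`; by Jacobi's triple product identity
`Θ(y)` is the product in `θ₁`. Put `E = ∏ (1 - qⁿ)`. The Laurent polynomial
`u (u^k - 1 - k (u - 1)) / (1 - u)²` has coefficients `gap n k`, nonzero only when `n` lies between
`0` and `k`. Multiplying by `θ_k` and summing over `k` gives `u Θ(u) / (1 - u)² - u E³ / (1 - u)`,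
because `∑ θ_k = 0` and `∑ k θ_k = -E³`.

Take `u = y q^i`, multiply by `θ_i y^i` and sum over `i`. By the quasi-periodicity
`Θ(y) = θ_i y^i Θ(y q^i)`, summing over `n` and `k` first yields `-Θ(y)` times the series of `s₁`
minus `E³ y` times the Appell–Lerch series. But `θ_i q^{in} = θ_{i+n} / θ_n`, so the same triple sum
also factors as `Θ(y) ∑ gap n k θ_k / θ_n`. This double series is invariant under
`(n, k) ↦ (1 - n, 1 - k)` and each half of it is `-F₂⁽²⁾`. -/

noncomputable section

namespace AppellLerch

open Filter Topology

/-! ### The finite triple product -/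

section FiniteTripleProduct

variable {K : Type*} [Field K] {q : K}

/-- The coefficient `(-1)^k q^{k(k-1)/2}` of `y^k` in Jacobi's theta series. The product `k (k - 1)`
is even, so the integer division by `2` is exact. -/
def thetaCoeff (q : K) (k : ℤ) : K := (-1) ^ k * q ^ (k * (k - 1) / 2)

lemma triangle_add (k n : ℤ) :
    (k + n) * (k + n - 1) / 2 = k * (k - 1) / 2 + n * (n - 1) / 2 + k * n := by
  obtain ⟨a, ha⟩ := Int.even_mul_pred_self k
  obtain ⟨b, hb⟩ := Int.even_mul_pred_self n
  have hab : (k + n) * (k + n - 1) = a + a + (b + b) + 2 * (k * n) := by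
    linear_combination ha + hb
  rw [hab]
  lia

@[simp] lemma thetaCoeff_zero (q : K) : thetaCoeff q 0 = 1 := by simp [thetaCoeff]

@[simp] lemma thetaCoeff_one (q : K) : thetaCoeff q 1 = -1 := by simp [thetaCoeff]

lemma thetaCoeff_ne_zero (hq : q ≠ 0) (k : ℤ) : thetaCoeff q k ≠ 0 :=
  mul_ne_zero (zpow_ne_zero _ (neg_ne_zero.2 one_ne_zero)) (zpow_ne_zero _ hq)

lemma thetaCoeff_add (hq : q ≠ 0) (k n : ℤ) :
    thetaCoeff q (k + n) = thetaCoeff q k * thetaCoeff q n * q ^ (k * n) := by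
  rw [thetaCoeff, thetaCoeff, thetaCoeff, triangle_add, zpow_add₀ hq, zpow_add₀ hq,
    zpow_add₀ (neg_ne_zero.2 one_ne_zero)]
  ring

lemma thetaCoeff_add_one (hq : q ≠ 0) (k : ℤ) :
    thetaCoeff q (k + 1) = -q ^ k * thetaCoeff q k := by
  rw [thetaCoeff_add hq, thetaCoeff_one, mul_one]
  ring

lemma thetaCoeff_one_sub (q : K) (k : ℤ) : thetaCoeff q (1 - k) = -thetaCoeff q k := by
  rw [thetaCoeff, thetaCoeff, show (1 - k) * (1 - k - 1) = k * (k - 1) by ring,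
    zpow_sub₀ (neg_ne_zero.2 one_ne_zero), zpow_one, div_eq_mul_inv, ← inv_zpow, inv_neg_one]
  ring

lemma thetaCoeff_neg (hq : q ≠ 0) (k : ℤ) : thetaCoeff q (-k) = q ^ k * thetaCoeff q k := by
  rw [show -k = 1 - (k + 1) by ring, thetaCoeff_one_sub, thetaCoeff_add_one hq]
  ring

/-- The `q`-Pochhammer symbol `(q; q)_n = (1 - q)(1 - q²)⋯(1 - qⁿ)`. -/
def qPochhammer (q : K) (n : ℕ) : K := ∏ i ∈ Finset.range n, (1 - q ^ (i + 1))

/-- The reciprocal `1 / (q; q)_m`, extended by zero to negative `m` so that the recurrence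
`qPochhammerInv_sub_one` holds for all integers. -/
def qPochhammerInv (q : K) (m : ℤ) : K := if m < 0 then 0 else (qPochhammer q m.toNat)⁻¹

/-- The coefficient `(-1)^k q^{k(k-1)/2} (q; q)_{2N} / ((q; q)_{N-k} (q; q)_{N+k})` of `y^k` in the
finite theta product `∏_{n < N} (1 - qⁿ y)(1 - q^{n+1} y⁻¹)`. -/
def finiteThetaCoeff (q : K) (N : ℕ) (k : ℤ) : K :=
  thetaCoeff q k * (qPochhammer q (2 * N) * qPochhammerInv q (N - k) * qPochhammerInv q (N + k))

lemma qPochhammer_succ (q : K) (n : ℕ) :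
    qPochhammer q (n + 1) = qPochhammer q n * (1 - q ^ (n + 1)) :=
  Finset.prod_range_succ _ _

lemma qPochhammerInv_sub_one (hroot : ∀ n : ℕ, q ^ (n + 1) ≠ 1) (m : ℤ) :
    qPochhammerInv q (m - 1) = (1 - q ^ m) * qPochhammerInv q m := by
  rcases lt_trichotomy m 0 with h | rfl | h
  · simp [qPochhammerInv, h, show m - 1 < 0 by lia]
  · simp [qPochhammerInv]
  · obtain ⟨n, rfl⟩ : ∃ n : ℕ, m = (n + 1 : ℕ) := ⟨(m - 1).toNat, by lia⟩
    have hn : 1 - q ^ (n + 1) ≠ 0 := sub_ne_zero.2 (hroot n).symm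
    rw [qPochhammerInv, qPochhammerInv, if_neg (by lia), if_neg (by lia), Int.toNat_natCast,
      show ((n + 1 : ℕ) - 1 : ℤ).toNat = n by lia, qPochhammer_succ, zpow_natCast, mul_inv]
    field_simp

lemma finiteThetaCoeff_zero (q : K) (k : ℤ) :
    finiteThetaCoeff q 0 k = if k = 0 then 1 else 0 := by
  rcases lt_trichotomy k 0 with h | rfl | h
  · simp [finiteThetaCoeff, qPochhammerInv, h, h.ne]
  · simp [finiteThetaCoeff, qPochhammerInv, qPochhammer]
  · simp [finiteThetaCoeff, qPochhammerInv, h, h.ne']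

lemma finiteThetaCoeff_succ (hq : q ≠ 0) (hroot : ∀ n : ℕ, q ^ (n + 1) ≠ 1) (N : ℕ) (k : ℤ) :
    finiteThetaCoeff q (N + 1) k = (1 + q ^ (2 * N + 1)) * finiteThetaCoeff q N k
      - q ^ N * finiteThetaCoeff q N (k - 1) - q ^ (N + 1) * finiteThetaCoeff q N (k + 1) := by
  have lower := qPochhammerInv_sub_one hroot
  have minus₁ := lower (N + 1 - k)
  have minus₂ := lower (N - k)
  have plus₁ := lower (N + 1 + k)
  have plus₂ := lower (N + k)
  rw [show (N : ℤ) + 1 - k - 1 = N - k by ring] at minus₁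
  rw [show (N : ℤ) + 1 + k - 1 = N + k by ring] at plus₁
  have theta_pred : thetaCoeff q (k - 1) = -(q ^ k)⁻¹ * q * thetaCoeff q k := by
    have hk := thetaCoeff_add_one hq (k - 1)
    have := zpow_ne_zero k hq
    rw [sub_add_cancel, zpow_sub_one₀ hq] at hk
    rw [hk]
    field_simp
  simp only [finiteThetaCoeff]
  rw [show (N : ℤ) - (k + 1) = N - k - 1 by ring, show (N : ℤ) + (k - 1) = N + k - 1 by ring,
    show (N : ℤ) - (k - 1) = N + 1 - k by ring, show (N : ℤ) + (k + 1) = N + 1 + k by ring,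
    minus₂, plus₂, minus₁, plus₁, thetaCoeff_add_one hq, theta_pred,
    show 2 * (N + 1) = 2 * N + 1 + 1 by ring, qPochhammer_succ, qPochhammer_succ]
  push_cast
  simp only [zpow_add₀ hq, zpow_sub₀ hq, zpow_natCast, zpow_one]
  have := zpow_ne_zero k hq
  field_simp
  ring

lemma hasSum_finiteThetaCoeff_mul_zpow [TopologicalSpace K] [IsTopologicalRing K] (hq : q ≠ 0)
    (hroot : ∀ n : ℕ, q ^ (n + 1) ≠ 1) {y : K} (hy : y ≠ 0) (N : ℕ) :
    HasSum (fun k : ℤ => finiteThetaCoeff q N k * y ^ k)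
      (∏ n ∈ Finset.range N, (1 - q ^ n * y) * (1 - q ^ (n + 1) * y⁻¹)) := by
  induction N with
  | zero =>
    rw [Finset.prod_range_zero]
    refine (hasSum_ite_eq (0 : ℤ) (1 : K)).congr_fun fun k => ?_
    rw [finiteThetaCoeff_zero]
    split_ifs with h <;> simp [h]
  | succ N ih =>
    rw [Finset.prod_range_succ]
    set P := ∏ n ∈ Finset.range N, (1 - q ^ n * y) * (1 - q ^ (n + 1) * y⁻¹)
    have raised := ((Equiv.subRight (1 : ℤ)).hasSum_iff.2 ih).mul_left (q ^ N * y)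
    have lowered := ((Equiv.addRight (1 : ℤ)).hasSum_iff.2 ih).mul_left (q ^ (N + 1) * y⁻¹)
    have expand : P * ((1 - q ^ N * y) * (1 - q ^ (N + 1) * y⁻¹)) =
        (1 + q ^ (2 * N + 1)) * P - q ^ N * y * P - q ^ (N + 1) * y⁻¹ * P := by
      field_simp
      ring
    rw [expand]
    refine (((ih.mul_left (1 + q ^ (2 * N + 1))).sub raised).sub lowered).congr_fun fun k => ?_
    simp only [finiteThetaCoeff_succ hq hroot, Function.comp_apply, Equiv.subRight_apply,
      Equiv.coe_addRight, zpow_sub_one₀ hy, zpow_add_one₀ hy]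
    field_simp

lemma hasSum_finiteThetaCoeff_succ_mul_intCast [TopologicalSpace K] [IsTopologicalRing K]
    (hq : q ≠ 0) (hroot : ∀ n : ℕ, q ^ (n + 1) ≠ 1) {N : ℕ} {a b : K}
    (ha : HasSum (finiteThetaCoeff q N) a)
    (hb : HasSum (fun k : ℤ => finiteThetaCoeff q N k * k) b) :
    HasSum (fun k : ℤ => finiteThetaCoeff q (N + 1) k * k)
      ((1 + q ^ (2 * N + 1)) * b - q ^ N * (b + a) - q ^ (N + 1) * (b - a)) := by
  have raised : HasSum (fun k : ℤ => finiteThetaCoeff q N (k - 1) * k) (b + a) :=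
    ((Equiv.subRight (1 : ℤ)).hasSum_iff.2 (hb.add ha)).congr_fun fun k => by
      simp only [Function.comp_apply, Equiv.subRight_apply]
      push_cast
      ring
  have lowered : HasSum (fun k : ℤ => finiteThetaCoeff q N (k + 1) * k) (b - a) :=
    ((Equiv.addRight (1 : ℤ)).hasSum_iff.2 (hb.sub ha)).congr_fun fun k => by
      simp only [Function.comp_apply, Equiv.coe_addRight]
      push_cast
      ring
  refine (((hb.mul_left (1 + q ^ (2 * N + 1))).sub (raised.mul_left (q ^ N))).sub
    (lowered.mul_left (q ^ (N + 1)))).congr_fun fun k => ?_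
  rw [finiteThetaCoeff_succ hq hroot]
  ring

lemma hasSum_finiteThetaCoeff_mul_intCast [TopologicalSpace K] [IsTopologicalRing K] (hq : q ≠ 0)
    (hroot : ∀ n : ℕ, q ^ (n + 1) ≠ 1) (N : ℕ) :
    HasSum (fun k : ℤ => finiteThetaCoeff q (N + 1) k * k)
      (-(qPochhammer q N * qPochhammer q (N + 1))) := by
  induction N with
  | zero =>
    have total : HasSum (finiteThetaCoeff q 0) 1 :=
      (hasSum_ite_eq (0 : ℤ) (1 : K)).congr_fun (finiteThetaCoeff_zero q)
    have moment : HasSum (fun k : ℤ => finiteThetaCoeff q 0 k * k) 0 :=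
      hasSum_zero.congr_fun fun k => by
        rw [finiteThetaCoeff_zero]
        split_ifs with h <;> simp [h]
    convert hasSum_finiteThetaCoeff_succ_mul_intCast hq hroot total moment using 1
    simp only [qPochhammer, zero_add, Finset.prod_range_zero, Finset.prod_range_one]
    ring
  | succ N ih =>
    have total : HasSum (finiteThetaCoeff q (N + 1)) 0 := by
      simpa [Finset.prod_range_succ'] using
        hasSum_finiteThetaCoeff_mul_zpow hq hroot one_ne_zero (N + 1)
    convert hasSum_finiteThetaCoeff_succ_mul_intCast hq hroot total ih using 1
    simp only [qPochhammer_succ]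
    ring

/-- Euler's product `∏_{n ≥ 1} (1 - qⁿ)`, that is, `(q; q)_∞`. -/
def eulerProd [TopologicalSpace K] (q : K) : K := ∏' n : ℕ, (1 - q ^ (n + 1))

/-- Jacobi's theta series `∑_k (-1)^k q^{k(k-1)/2} y^k`. -/
def thetaSeries [TopologicalSpace K] (q y : K) : K := ∑' k : ℤ, thetaCoeff q k * y ^ k

/-- The factor of index `n + 1` in the Jacobi triple product. -/
def jacobiFactor (q y : K) (n : ℕ) : K :=
  (1 - q ^ (n + 1)) * (1 - q ^ n * y) * (1 - q ^ (n + 1) * y⁻¹)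

end FiniteTripleProduct

/-! ### The theta series and Euler's product -/

section ThetaSeries

variable {K : Type*} [NormedField K] {q : K}

lemma pow_succ_ne_one (h1 : ‖q‖ < 1) (n : ℕ) : q ^ (n + 1) ≠ 1 := fun h => by
  have hlt := pow_lt_one₀ (norm_nonneg q) h1 n.succ_ne_zero
  rw [← norm_pow, h, norm_one] at hlt
  exact hlt.false

lemma summable_norm_thetaCoeff_mul_pow (hq : q ≠ 0) (h1 : ‖q‖ < 1) {ρ : ℝ} (hρ : 0 < ρ) :
    Summable fun n : ℕ => ‖thetaCoeff q n‖ * ρ ^ n := by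
  have term_ne_zero (n : ℕ) : ‖thetaCoeff q n‖ * ρ ^ n ≠ 0 :=
    mul_ne_zero (norm_ne_zero_iff.2 (thetaCoeff_ne_zero hq n)) (pow_pos hρ n).ne'
  refine summable_of_ratio_test_tendsto_lt_one (l := 0) zero_lt_one (.of_forall term_ne_zero) ?_
  have ratio := (tendsto_pow_atTop_nhds_zero_of_lt_one (norm_nonneg q) h1).mul_const ρ
  rw [zero_mul] at ratio
  refine ratio.congr fun n => ?_
  rw [eq_div_iff (norm_ne_zero_iff.2 (term_ne_zero n)), Real.norm_of_nonneg (by positivity),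
    Real.norm_of_nonneg (by positivity), Nat.cast_succ, thetaCoeff_add_one hq, norm_mul, norm_neg,
    zpow_natCast, norm_pow]
  ring

lemma summable_norm_thetaCoeff_mul_zpow (hq : q ≠ 0) (h1 : ‖q‖ < 1) {ρ : ℝ} (hρ : 0 < ρ) :
    Summable fun k : ℤ => ‖thetaCoeff q k‖ * ρ ^ k := by
  refine Summable.of_nat_of_neg ?_ ?_
  · simpa only [zpow_natCast] using summable_norm_thetaCoeff_mul_pow hq h1 hρ
  · refine (summable_norm_thetaCoeff_mul_pow hq h1
      (div_pos (norm_pos_iff.2 hq) hρ)).congr fun n => ?_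
    rw [thetaCoeff_neg hq, norm_mul, zpow_natCast, norm_pow, zpow_neg, zpow_natCast, div_pow]
    ring

lemma summable_norm_thetaSeries (hq : q ≠ 0) (h1 : ‖q‖ < 1) {y : K} (hy : y ≠ 0) :
    Summable fun k : ℤ => ‖thetaCoeff q k * y ^ k‖ := by
  simpa only [norm_mul, norm_zpow] using
    summable_norm_thetaCoeff_mul_zpow hq h1 (norm_pos_iff.2 hy)

lemma norm_intCast_le_two_zpow_add (k : ℤ) : ‖(k : K)‖ ≤ 2 ^ k + (2⁻¹) ^ k := by
  have bound (n : ℕ) : ‖(n : K)‖ ≤ 2 ^ n := by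
    have hn : (n : ℝ) ≤ 2 ^ n := by exact_mod_cast Nat.lt_two_pow_self.le
    simpa only [norm_one, mul_one] using (Nat.norm_cast_le n).trans (by simpa using hn)
  rw [inv_zpow']
  obtain ⟨n, rfl | rfl⟩ := k.eq_nat_or_neg
  · simpa using (bound n).trans (le_add_of_nonneg_right (by positivity))
  · simpa using (bound n).trans (le_add_of_nonneg_left (by positivity))

lemma summable_norm_thetaCoeff_mul_intCast (hq : q ≠ 0) (h1 : ‖q‖ < 1) :
    Summable fun k : ℤ => ‖thetaCoeff q k * k‖ := by
  refine .of_nonneg_of_le (fun _ => norm_nonneg _) (fun k => ?_)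
    ((summable_norm_thetaCoeff_mul_zpow hq h1 (ρ := 2) two_pos).add
      (summable_norm_thetaCoeff_mul_zpow hq h1 (ρ := 2⁻¹) (by norm_num)))
  rw [norm_mul, ← mul_add]
  gcongr
  exact norm_intCast_le_two_zpow_add k

lemma summable_norm_neg_pow_mul (h1 : ‖q‖ < 1) (a : K) : Summable fun n : ℕ => ‖-(q ^ n * a)‖ := by
  simpa [norm_mul, norm_pow] using (summable_geometric_of_lt_one (norm_nonneg q) h1).mul_right ‖a‖

variable [CompleteSpace K]

lemma multipliable_one_sub_pow_mul (h1 : ‖q‖ < 1) (a : K) :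
    Multipliable fun n : ℕ => 1 - q ^ n * a := by
  simpa only [sub_eq_add_neg] using
    multipliable_one_add_of_summable (summable_norm_neg_pow_mul h1 a)

lemma tprod_one_sub_pow_mul_ne_zero (h1 : ‖q‖ < 1) {a : K} (ha : ∀ n : ℕ, q ^ n * a ≠ 1) :
    ∏' n : ℕ, (1 - q ^ n * a) ≠ 0 := by
  simp only [sub_eq_add_neg]
  refine tprod_one_add_ne_zero_of_summable (fun n => ?_) (summable_norm_neg_pow_mul h1 a)
  simpa only [← sub_eq_add_neg] using sub_ne_zero.2 (ha n).symm

lemma multipliable_one_sub_pow_succ (h1 : ‖q‖ < 1) :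
    Multipliable fun n : ℕ => 1 - q ^ (n + 1) := by
  simpa only [pow_succ] using multipliable_one_sub_pow_mul h1 q

lemma eulerProd_ne_zero (h1 : ‖q‖ < 1) : eulerProd q ≠ 0 := by
  simpa only [eulerProd, pow_succ] using
    tprod_one_sub_pow_mul_ne_zero h1 fun n => by simpa only [← pow_succ] using pow_succ_ne_one h1 n

lemma tendsto_qPochhammer (h1 : ‖q‖ < 1) : Tendsto (qPochhammer q) atTop (𝓝 (eulerProd q)) :=
  (multipliable_one_sub_pow_succ h1).hasProd.tendsto_prod_nat

lemma tendsto_qPochhammerInv (h1 : ‖q‖ < 1) :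
    Tendsto (qPochhammerInv q) atTop (𝓝 (eulerProd q)⁻¹) := by
  have toNat : Tendsto Int.toNat atTop atTop := tendsto_atTop.2 fun b => by
    filter_upwards [eventually_ge_atTop (b : ℤ)] with m hm
    lia
  refine (((tendsto_qPochhammer h1).inv₀ (eulerProd_ne_zero h1)).comp toNat).congr' ?_
  filter_upwards [eventually_ge_atTop 0] with m hm
  simp [qPochhammerInv, hm.not_gt]

lemma exists_norm_qPochhammer_le (h1 : ‖q‖ < 1) : ∃ C, ∀ n, ‖qPochhammer q n‖ ≤ C := by
  obtain ⟨C, hC⟩ := (tendsto_qPochhammer h1).norm.bddAbove_range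
  exact ⟨C, fun n => hC ⟨n, rfl⟩⟩

lemma exists_norm_qPochhammerInv_le (h1 : ‖q‖ < 1) : ∃ C, ∀ m, ‖qPochhammerInv q m‖ ≤ C := by
  obtain ⟨C, hC⟩ :=
    ((tendsto_qPochhammer h1).inv₀ (eulerProd_ne_zero h1)).norm.bddAbove_range
  have bound (n : ℕ) : ‖(qPochhammer q n)⁻¹‖ ≤ C := hC ⟨n, rfl⟩
  refine ⟨C, fun m => ?_⟩
  rw [qPochhammerInv]
  split_ifs
  · simpa only [norm_zero] using (norm_nonneg _).trans (bound 0)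
  · exact bound _

lemma tendsto_tsum_finiteThetaCoeff_mul (h1 : ‖q‖ < 1) {w : ℤ → K}
    (hw : Summable fun k => ‖thetaCoeff q k * w k‖) :
    Tendsto (fun N : ℕ => ∑' k, finiteThetaCoeff q N k * w k) atTop
      (𝓝 ((∑' k, thetaCoeff q k * w k) * (eulerProd q)⁻¹)) := by
  obtain ⟨C, hC⟩ := exists_norm_qPochhammer_le h1
  obtain ⟨D, hD⟩ := exists_norm_qPochhammerInv_le h1
  have hC0 : 0 ≤ C := (norm_nonneg _).trans (hC 0)
  have hD0 : 0 ≤ D := (norm_nonneg _).trans (hD 0)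
  rw [← tsum_mul_right]
  refine tendsto_tsum_of_dominated_convergence (hw.mul_right (C * D * D)) (fun k => ?_)
    (.of_forall fun N k => ?_)
  · have double : Tendsto (fun N : ℕ => 2 * N) atTop atTop :=
      tendsto_id.const_mul_atTop' two_pos
    have minus : Tendsto (fun N : ℕ => (N : ℤ) - k) atTop atTop :=
      tendsto_atTop_add_const_right _ (-k) tendsto_natCast_atTop_atTop
    have plus : Tendsto (fun N : ℕ => (N : ℤ) + k) atTop atTop :=
      tendsto_atTop_add_const_right _ k tendsto_natCast_atTop_atTop
    have ratio := (((tendsto_qPochhammer h1).comp double).mul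
      ((tendsto_qPochhammerInv h1).comp minus)).mul ((tendsto_qPochhammerInv h1).comp plus)
    rw [mul_inv_cancel₀ (eulerProd_ne_zero h1), one_mul] at ratio
    refine (ratio.const_mul (thetaCoeff q k * w k)).congr fun N => ?_
    simp only [finiteThetaCoeff, Function.comp_apply]
    ring
  · rw [finiteThetaCoeff, mul_right_comm, norm_mul]
    gcongr
    rw [norm_mul, norm_mul]
    gcongr
    exacts [hC _, hD _, hD _]

lemma multipliable_jacobiFactor (h1 : ‖q‖ < 1) (y : K) : Multipliable (jacobiFactor q y) := by
  have inverse := multipliable_one_sub_pow_mul h1 (q * y⁻¹)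
  simp only [← mul_assoc, ← pow_succ] at inverse
  exact ((multipliable_one_sub_pow_succ h1).mul (multipliable_one_sub_pow_mul h1 y)).mul inverse

lemma tprod_jacobiFactor_ne_zero (h1 : ‖q‖ < 1) {y : K} (hy : y ≠ 0)
    (hqy : ∀ k : ℤ, y * q ^ k ≠ 1) : ∏' n : ℕ, jacobiFactor q y n ≠ 0 := by
  have euler := multipliable_one_sub_pow_succ h1
  have direct := multipliable_one_sub_pow_mul h1 y
  have inverse := multipliable_one_sub_pow_mul h1 (q * y⁻¹)
  have direct_ne : ∏' n : ℕ, (1 - q ^ n * y) ≠ 0 := tprod_one_sub_pow_mul_ne_zero h1 fun n => by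
    simpa only [zpow_natCast, mul_comm] using hqy n
  have inverse_ne : ∏' n : ℕ, (1 - q ^ n * (q * y⁻¹)) ≠ 0 :=
    tprod_one_sub_pow_mul_ne_zero h1 fun n h => hqy (-(n + 1 : ℕ)) (by
      rw [← mul_assoc, ← pow_succ, ← div_eq_mul_inv, div_eq_one_iff_eq hy] at h
      rw [zpow_neg, zpow_natCast, h, mul_inv_cancel₀ hy])
  simp only [← mul_assoc, ← pow_succ] at inverse inverse_ne
  simp only [jacobiFactor]
  rw [(euler.mul direct).tprod_mul inverse, euler.tprod_mul direct]
  exact mul_ne_zero (mul_ne_zero (eulerProd_ne_zero h1) direct_ne) inverse_ne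

theorem thetaSeries_eq_tprod (hq : q ≠ 0) (h1 : ‖q‖ < 1) {y : K} (hy : y ≠ 0) :
    thetaSeries q y = ∏' n : ℕ, jacobiFactor q y n := by
  have series := (tendsto_qPochhammer h1).mul (tendsto_tsum_finiteThetaCoeff_mul h1
    (summable_norm_thetaSeries hq h1 hy))
  rw [mul_comm (∑' _, _), mul_inv_cancel_left₀ (eulerProd_ne_zero h1)] at series
  simp only [(hasSum_finiteThetaCoeff_mul_zpow hq (pow_succ_ne_one h1) hy _).tsum_eq,
    qPochhammer, ← Finset.prod_mul_distrib, ← mul_assoc] at series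
  exact tendsto_nhds_unique series (multipliable_jacobiFactor h1 y).hasProd.tendsto_prod_nat

lemma tsum_thetaCoeff (hq : q ≠ 0) (h1 : ‖q‖ < 1) : ∑' k : ℤ, thetaCoeff q k = 0 := by
  have theta_one := thetaSeries_eq_tprod hq h1 one_ne_zero
  rw [tprod_of_exists_eq_zero ⟨0, by simp [jacobiFactor]⟩] at theta_one
  simpa only [thetaSeries, one_zpow, mul_one] using theta_one

theorem tsum_thetaCoeff_mul_intCast (hq : q ≠ 0) (h1 : ‖q‖ < 1) :
    ∑' k : ℤ, thetaCoeff q k * k = -eulerProd q ^ 3 := by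
  have series := (tendsto_tsum_finiteThetaCoeff_mul h1
    (summable_norm_thetaCoeff_mul_intCast hq h1)).comp (tendsto_add_atTop_nat 1)
  have euler := tendsto_qPochhammer h1
  have square := (euler.mul (euler.comp (tendsto_add_atTop_nat 1))).neg
  have := tendsto_nhds_unique series (square.congr fun N =>
    (hasSum_finiteThetaCoeff_mul_intCast hq (pow_succ_ne_one h1) N).tsum_eq.symm)
  rw [← div_eq_mul_inv, div_eq_iff (eulerProd_ne_zero h1)] at this
  rw [this]
  ring

end ThetaSeries

/-! ### Gap coefficients -/

section Gap

/-- The coefficient `gap n k` of `uⁿ` in the Laurent polynomial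
`u (u^k - 1 - k (u - 1)) / (1 - u)²`: it is `k - n` for `0 < n < k`, `n - k` for `k < n ≤ 0`, and
zero otherwise. -/
def gap (n k : ℤ) : ℕ := if 0 < n then (k - n).toNat else (n - k).toNat

lemma gap_zero_right (n : ℤ) : gap n 0 = 0 := by
  rw [gap]
  split_ifs <;> lia

lemma gap_one_sub_one_sub (n k : ℤ) : gap (1 - n) (1 - k) = gap n k := by
  rw [gap, gap]
  split_ifs <;> lia

lemma gap_add_one_right (n k : ℤ) :
    (gap n (k + 1) : ℤ) = gap (n - 1) k + if n = 1 then k else 0 := by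
  rw [gap, gap]
  split_ifs <;> lia

variable {K : Type*} [Field K] [TopologicalSpace K] [IsTopologicalRing K] {u : K}

lemma hasSum_gap_add_one_iff (hu : u ≠ 0) {k : ℤ} {a : K} :
    HasSum (fun n => (gap n (k + 1) : K) * u ^ n) (u * a + k * u) ↔
      HasSum (fun n => (gap n k : K) * u ^ n) a := by
  have shift : HasSum (fun n => u * ((gap (n - 1) k : K) * u ^ (n - 1))) (u * a) ↔
      HasSum (fun n => (gap n k : K) * u ^ n) a :=
    (hasSum_mul_left_iff hu).trans
      ((Equiv.subRight 1).hasSum_iff (f := fun n => (gap n k : K) * u ^ n))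
  have spike := hasSum_ite_eq (1 : ℤ) (k * u)
  have recurrence (n : ℤ) : (gap n (k + 1) : K) * u ^ n =
      u * ((gap (n - 1) k : K) * u ^ (n - 1)) + if n = 1 then k * u else 0 := by
    have cast := congrArg (Int.cast (R := K)) (gap_add_one_right n k)
    push_cast at cast
    rw [cast, zpow_sub_one₀ hu]
    split_ifs with hn
    · subst hn
      field_simp
    · field_simp
      ring
  simp only [recurrence, ← shift]
  exact ⟨fun h => by simpa using h.sub spike, fun h => h.add spike⟩

lemma hasSum_gap_mul_zpow (hu : u ≠ 0) (hu1 : u ≠ 1) (k : ℤ) :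
    HasSum (fun n => (gap n k : K) * u ^ n) (u * (u ^ k - 1 - k * (u - 1)) / (1 - u) ^ 2) := by
  have hu1 : 1 - u ≠ 0 := sub_ne_zero.2 hu1.symm
  have closed_form_add_one (k : ℤ) : u * (u ^ (k + 1) - 1 - (k + 1 : ℤ) * (u - 1)) / (1 - u) ^ 2 =
      u * (u * (u ^ k - 1 - k * (u - 1)) / (1 - u) ^ 2) + k * u := by
    rw [zpow_add_one₀ hu]
    push_cast
    field_simp
    ring
  induction k with
  | zero => simp [gap_zero_right]
  | succ k ih =>
    rw [closed_form_add_one]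
    exact (hasSum_gap_add_one_iff hu).2 ih
  | pred k ih =>
    rw [← hasSum_gap_add_one_iff hu, ← closed_form_add_one, sub_add_cancel]
    exact ih

end Gap

lemma hasSum_of_reflection {E : Type*} [AddCommMonoid E] [TopologicalSpace E] [ContinuousAdd E]
    {f : ℤ × ℤ → E} {a : E} (hsymm : ∀ n k, f (1 - n, 1 - k) = f (n, k))
    (hzero : ∀ n k, 0 < n → k ≤ n → f (n, k) = 0)
    (h : HasSum (fun p : ℕ × ℕ => f (p.1 + 1, p.1 + p.2 + 2)) a) : HasSum f (a + a) := by
  set g : ℤ × ℤ → E := fun p => if 0 < p.1 then f p else 0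
  have cone_injective : Function.Injective fun p : ℕ × ℕ => ((p.1 + 1 : ℤ), (p.1 + p.2 + 2 : ℤ)) :=
    fun p p' hp => by
      rw [Prod.mk.injEq] at hp
      ext <;> lia
  have hg : HasSum g a := by
    refine (cone_injective.hasSum_iff fun p hp => ?_).1 (h.congr_fun fun p => if_pos (by simp))
    obtain ⟨n, k⟩ := p
    refine ite_eq_right_iff.2 fun hn => hzero n k hn (not_lt.1 fun hnk => hp ?_)
    exact ⟨((n - 1).toNat, (k - n - 1).toNat), by ext <;> dsimp only <;> lia⟩
  have reflected := ((Equiv.subLeft (1 : ℤ)).prodCongr (Equiv.subLeft (1 : ℤ))).hasSum_iff.2 hg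
  refine (hg.add reflected).congr_fun fun ⟨n, k⟩ => ?_
  by_cases hn : 0 < n
  · simp [g, hn, show ¬ n < 1 by lia]
  · simp [g, hn, show n < 1 by lia, hsymm]

section GapWeight

variable {K : Type*} [Field K] {q : K}

/-- The weight `gap n k θ_k / θ_n`, where `θ_k` is the theta coefficient of index `k`. On the cone
`0 < n < k` these weights are, up to sign, the terms of `F₂⁽²⁾`, with `r = n + k - 1` and
`s = k - n`. -/
def gapWeight (q : K) (p : ℤ × ℤ) : K := gap p.1 p.2 * (thetaCoeff q p.2 / thetaCoeff q p.1)

lemma gapWeight_one_sub (q : K) (n k : ℤ) : gapWeight q (1 - n, 1 - k) = gapWeight q (n, k) := by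
  simp only [gapWeight, gap_one_sub_one_sub, thetaCoeff_one_sub, neg_div_neg_eq]

lemma gapWeight_eq_zero (q : K) {n k : ℤ} (hn : 0 < n) (hk : k ≤ n) : gapWeight q (n, k) = 0 := by
  simp [gapWeight, gap, hn, Int.toNat_of_nonpos (sub_nonpos.2 hk)]

/-- The term `(-1)^r s q^{rs/2}` of `F₂⁽²⁾`, over an arbitrary field; the division by `2` is
exact. -/
def oddGapTerm (q : K) (p : HodgeElliptic.OddGapPair) : K :=
  (-1) ^ p.1.1 * (p.1.2 : K) * q ^ (p.1.1 * p.1.2 / 2)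

/-- The parametrisation `s = t + 1`, `r = s + 2 m + 1` by `(m, t)` of the pairs `r > s > 0` of
opposite parity. -/
def oddGapEquiv : ℕ × ℕ ≃ HodgeElliptic.OddGapPair where
  toFun p := ⟨(p.2 + 1 + (2 * p.1 + 1), p.2 + 1), by simp⟩
  invFun p := ((p.1.1 - p.1.2) / 2, p.1.2 - 1)
  left_inv p := by ext <;> dsimp only <;> lia
  right_inv := by
    rintro ⟨⟨r, s⟩, hs, hrs, m, hm⟩
    refine Subtype.ext (Prod.ext ?_ ?_) <;> dsimp only at * <;> lia

lemma oddGapTerm_oddGapEquiv (q : K) (p : ℕ × ℕ) : oddGapTerm q (oddGapEquiv p) =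
    (-1) ^ p.2 * (p.2 + 1 : ℕ) * q ^ ((p.2 + 1) * p.2 / 2 + (p.2 + 1) * (p.1 + 1)) := by
  obtain ⟨m, t⟩ := p
  have exponent : (t + 1 + (2 * m + 1)) * (t + 1) / 2 = (t + 1) * t / 2 + (t + 1) * (m + 1) := by
    rw [← Nat.add_mul_div_left _ _ two_pos]
    ring_nf
  have sign : (-1 : K) ^ (t + 1 + (2 * m + 1)) = (-1) ^ t := by
    rw [show t + 1 + (2 * m + 1) = t + 2 * (m + 1) by ring, pow_add, pow_mul, neg_one_sq, one_pow,
      mul_one]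
  rw [← exponent, ← sign]
  rfl

lemma gapWeight_eq_neg_oddGapTerm (hq : q ≠ 0) (p : ℕ × ℕ) :
    gapWeight q (p.1 + 1, p.1 + p.2 + 2) = -oddGapTerm q (oddGapEquiv p) := by
  obtain ⟨m, t⟩ := p
  have hgap : gap (m + 1) (m + t + 2) = t + 1 := by
    rw [gap, if_pos (by lia)]
    lia
  have htheta : thetaCoeff q (m + t + 2) =
      thetaCoeff q (t + 1 : ℕ) * q ^ ((t + 1) * (m + 1)) * thetaCoeff q (m + 1) := by
    rw [show (m + t + 2 : ℤ) = (t + 1 : ℕ) + (m + 1) by push_cast; ring, thetaCoeff_add hq,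
      mul_right_comm]
    norm_cast
  have htri : thetaCoeff q (t + 1 : ℕ) = -((-1) ^ t * q ^ ((t + 1) * t / 2)) := by
    rw [thetaCoeff, zpow_natCast, show ((t + 1 : ℕ) : ℤ) * ((t + 1 : ℕ) - 1) / 2 =
      ((t + 1) * t / 2 : ℕ) by push_cast; ring_nf, zpow_natCast]
    ring
  rw [gapWeight, hgap, htheta, mul_div_cancel_right₀ _ (thetaCoeff_ne_zero hq _), htri,
    oddGapTerm_oddGapEquiv, pow_add]
  ring

end GapWeight

/-! ### The triple sum -/

section SeriesTerms

variable {K : Type*} [Field K] {q y : K}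

/-- The reindexing `(i, (n, k)) ↦ (i + n, (n, k))` that decouples the theta series from the double
series of gap weights. -/
def shearEquiv : ℤ × (ℤ × ℤ) ≃ ℤ × (ℤ × ℤ) where
  toFun p := (p.1 + p.2.1, p.2)
  invFun p := (p.1 - p.2.1, p.2)
  left_inv p := by simp
  right_inv p := by simp

lemma thetaCoeff_mul_gap (hq : q ≠ 0) (hy : y ≠ 0) (i n k : ℤ) :
    thetaCoeff q i * y ^ i * (gap n k * thetaCoeff q k * (y * q ^ i) ^ n) =
      thetaCoeff q (i + n) * y ^ (i + n) * gapWeight q (n, k) := by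
  have := thetaCoeff_ne_zero hq n
  rw [gapWeight, thetaCoeff_add hq, zpow_add₀ hy, mul_zpow, ← zpow_mul]
  field_simp

/-- The `l`-th term `(-1)^l y^l q^{l(l+1)/2} / (1 - y q^l)` of the Appell–Lerch sum. -/
def appellTerm (q y : K) (l : ℤ) : K :=
  (-1) ^ l * y ^ l * q ^ (l * (l + 1) / 2) / (1 - y * q ^ l)

/-- The elliptic summand `1 / ((1 - y q^i)(1 - y⁻¹ q^{-i}))`, with a double pole at `y = q^{-i}`. -/
def poleTerm (q y : K) (i : ℤ) : K := 1 / ((1 - y * q ^ i) * (1 - y⁻¹ * q ^ (-i)))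

lemma appellTerm_eq_thetaCoeff_mul (hq : q ≠ 0) (y : K) (l : ℤ) :
    appellTerm q y l = thetaCoeff q l * (q * y) ^ l * (1 - y * q ^ l)⁻¹ := by
  have triangle : l * (l + 1) / 2 = l * (l - 1) / 2 + l := by
    rw [← Int.add_mul_ediv_right _ _ two_ne_zero]
    ring_nf
  rw [appellTerm, thetaCoeff, triangle, zpow_add₀ hq, mul_zpow]
  ring

lemma poleTerm_eq_neg_div_sq (hq : q ≠ 0) (hy : y ≠ 0) {i : ℤ} (hi : y * q ^ i ≠ 1) :
    poleTerm q y i = -(y * q ^ i) / (1 - y * q ^ i) ^ 2 := by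
  have hu : y * q ^ i ≠ 0 := mul_ne_zero hy (zpow_ne_zero i hq)
  rw [poleTerm, zpow_neg, ← mul_inv]
  generalize y * q ^ i = u at *
  have : 1 - u ≠ 0 := sub_ne_zero.2 hi.symm
  rw [show 1 - u⁻¹ = -(1 - u) / u by field_simp; ring]
  field_simp

end SeriesTerms

section TripleSum

variable {K : Type*} [NormedField K] {q y : K}

lemma norm_oddGapTerm_le (h1 : ‖q‖ < 1) (p : ℕ × ℕ) :
    ‖oddGapTerm q (oddGapEquiv p)‖ ≤ ‖q‖ ^ p.1 * ((p.2 + 1 : ℕ) * ‖q‖ ^ p.2) := by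
  obtain ⟨m, t⟩ := p
  have coeff : ‖((t + 1 : ℕ) : K)‖ ≤ (t + 1 : ℕ) := by
    simpa only [norm_one, mul_one] using Nat.norm_cast_le (α := K) (t + 1)
  have exponent : m + t ≤ (t + 1) * t / 2 + (t + 1) * (m + 1) := by
    rw [add_one_mul t (m + 1)]
    lia
  rw [oddGapTerm_oddGapEquiv, norm_mul, norm_mul, norm_pow, norm_neg, norm_one, one_pow, one_mul,
    norm_pow, mul_left_comm, ← pow_add]
  exact mul_le_mul coeff (pow_le_pow_of_le_one (norm_nonneg q) h1.le exponent) (by positivity)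
    (by positivity)

lemma summable_norm_oddGapTerm (h1 : ‖q‖ < 1) : Summable fun p => ‖oddGapTerm q p‖ := by
  have geometric := summable_geometric_of_lt_one (norm_nonneg q) h1
  have linear : Summable fun t : ℕ => (t : ℝ) * ‖q‖ ^ t := by
    simpa only [pow_one] using summable_pow_mul_geometric_of_norm_lt_one 1 (by simpa using h1)
  have arith : Summable fun t : ℕ => ((t + 1 : ℕ) : ℝ) * ‖q‖ ^ t :=
    (linear.add geometric).congr fun t => by push_cast; ring
  exact oddGapEquiv.summable_iff.1 (.of_nonneg_of_le (fun _ => norm_nonneg _)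
    (norm_oddGapTerm_le h1)
    (geometric.mul_of_nonneg arith (fun _ => by positivity) fun _ => by positivity))

lemma summable_norm_gapWeight (hq : q ≠ 0) (h1 : ‖q‖ < 1) :
    Summable fun p => ‖gapWeight q p‖ := by
  have cone : HasSum (fun p : ℕ × ℕ => ‖gapWeight q (p.1 + 1, p.1 + p.2 + 2)‖)
      (∑' p, ‖oddGapTerm q (oddGapEquiv p)‖) :=
    (oddGapEquiv.summable_iff.2 (summable_norm_oddGapTerm h1)).hasSum.congr_fun fun p => by
      rw [gapWeight_eq_neg_oddGapTerm hq, norm_neg, Function.comp_apply]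
  exact (hasSum_of_reflection (f := fun p => ‖gapWeight q p‖)
    (fun n k => congrArg norm (gapWeight_one_sub q n k))
    (fun n k hn hk => by rw [gapWeight_eq_zero q hn hk, norm_zero]) cone).summable

lemma thetaSeries_eq_thetaCoeff_mul (hq : q ≠ 0) (hy : y ≠ 0) (i : ℤ) :
    thetaSeries q y = thetaCoeff q i * y ^ i * thetaSeries q (y * q ^ i) := by
  rw [thetaSeries, thetaSeries, ← tsum_mul_left, ← (Equiv.addRight i).tsum_eq]
  refine tsum_congr fun k => ?_
  rw [Equiv.coe_addRight, thetaCoeff_add hq, zpow_add₀ hy, mul_zpow, ← zpow_mul, mul_comm i k]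
  ring

lemma exists_norm_inv_one_sub_mul_zpow_le (hq : q ≠ 0) (h1 : ‖q‖ < 1) (hy : y ≠ 0) :
    ∃ C, ∀ i : ℤ, ‖(1 - y * q ^ i)⁻¹‖ ≤ C := by
  have natural (a : K) : ∃ C, ∀ n : ℕ, ‖(1 - a * q ^ n)⁻¹‖ ≤ C := by
    have lim := ((tendsto_pow_atTop_nhds_zero_of_norm_lt_one h1).const_mul a).const_sub 1
    rw [mul_zero, sub_zero] at lim
    obtain ⟨C, hC⟩ := (lim.inv₀ one_ne_zero).norm.bddAbove_range
    exact ⟨C, fun n => hC ⟨n, rfl⟩⟩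
  have inversion {u : K} (hu : u ≠ 0) : ‖(1 - u⁻¹)⁻¹‖ ≤ 1 + ‖(1 - u)⁻¹‖ := by
    by_cases hu1 : u = 1
    · simp [hu1]
    · have : 1 - u ≠ 0 := sub_ne_zero.2 (Ne.symm hu1)
      have : (1 - u⁻¹)⁻¹ = 1 - (1 - u)⁻¹ := by
        rw [show 1 - u⁻¹ = -(1 - u) / u by field_simp; ring]
        field_simp
        ring
      simpa only [this, norm_one] using norm_sub_le 1 (1 - u)⁻¹
  obtain ⟨C, hC⟩ := natural y
  obtain ⟨D, hD⟩ := natural y⁻¹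
  refine ⟨max C (1 + D), fun i => ?_⟩
  obtain ⟨n, rfl | rfl⟩ := i.eq_nat_or_neg
  · exact le_max_of_le_left (by simpa only [zpow_natCast] using hC n)
  · refine le_max_of_le_right (le_trans ?_ (add_le_add_right (hD n) 1))
    simpa [mul_comm] using inversion (mul_ne_zero (inv_ne_zero hy) (pow_ne_zero n hq))

variable [CompleteSpace K]

lemma hasSum_gapWeight (hq : q ≠ 0) (h1 : ‖q‖ < 1) :
    HasSum (gapWeight q) (-(2 * ∑' p, oddGapTerm q p)) := by
  rw [two_mul, neg_add]
  exact hasSum_of_reflection (gapWeight_one_sub q) (fun n k => gapWeight_eq_zero q)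
    ((oddGapEquiv.hasSum_iff.2 (summable_norm_oddGapTerm h1).of_norm.hasSum).neg.congr_fun
      fun p => gapWeight_eq_neg_oddGapTerm hq p)

lemma hasSum_thetaCoeff_mul_gap (hq : q ≠ 0) (h1 : ‖q‖ < 1) (hy : y ≠ 0) :
    HasSum (fun p : ℤ × (ℤ × ℤ) => thetaCoeff q p.1 * y ^ p.1 *
        (gap p.2.1 p.2.2 * thetaCoeff q p.2.2 * (y * q ^ p.1) ^ p.2.1))
      (thetaSeries q y * -(2 * ∑' p, oddGapTerm q p)) := by
  have norms := summable_norm_thetaSeries hq h1 hy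
  have theta : HasSum (fun i => thetaCoeff q i * y ^ i) (thetaSeries q y) := norms.of_norm.hasSum
  have summable_product := summable_mul_of_summable_norm norms (summable_norm_gapWeight hq h1)
  have product := theta.mul (hasSum_gapWeight hq h1) summable_product
  refine (shearEquiv.hasSum_iff.2 product).congr_fun fun p => ?_
  exact thetaCoeff_mul_gap hq hy p.1 p.2.1 p.2.2

lemma hasSum_gap_mul_thetaCoeff (hq : q ≠ 0) (h1 : ‖q‖ < 1) {u : K} (hu : u ≠ 0) (hu1 : u ≠ 1) :
    HasSum (fun p : ℤ × ℤ => gap p.1 p.2 * thetaCoeff q p.2 * u ^ p.1)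
      (u * thetaSeries q u / (1 - u) ^ 2 - u * eulerProd q ^ 3 / (1 - u)) := by
  have summable : Summable fun p : ℤ × ℤ => gap p.1 p.2 * thetaCoeff q p.2 * u ^ p.1 := by
    simpa using (hasSum_thetaCoeff_mul_gap hq h1 hu).summable.prod_factor 0
  have rows (k : ℤ) : HasSum (fun n => gap n k * thetaCoeff q k * u ^ n)
      (thetaCoeff q k * (u * (u ^ k - 1 - k * (u - 1)) / (1 - u) ^ 2)) :=
    ((hasSum_gap_mul_zpow hu hu1 k).mul_left (thetaCoeff q k)).congr_fun fun n => by ring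
  have by_rows := ((Equiv.prodComm ℤ ℤ).hasSum_iff.2 summable.hasSum).prod_fiberwise rows
  have theta := (summable_norm_thetaSeries hq h1 hu).of_norm.hasSum
  have zero := (summable_norm_thetaSeries hq h1 one_ne_zero).of_norm.hasSum
  simp only [one_zpow, mul_one, tsum_thetaCoeff hq h1] at zero
  have euler := (summable_norm_thetaCoeff_mul_intCast hq h1).of_norm.hasSum
  rw [tsum_thetaCoeff_mul_intCast hq h1] at euler
  have closed_form := (((theta.sub zero).sub (euler.mul_right (u - 1))).mul_left
    (u / (1 - u) ^ 2)).congr_fun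
    (g := fun k => thetaCoeff q k * (u * (u ^ k - 1 - k * (u - 1)) / (1 - u) ^ 2)) fun k => by ring
  convert summable.hasSum using 1
  rw [by_rows.unique closed_form, ← thetaSeries]
  have : 1 - u ≠ 0 := sub_ne_zero.2 hu1.symm
  field_simp
  ring

lemma summable_appellTerm (hq : q ≠ 0) (h1 : ‖q‖ < 1) (hy : y ≠ 0) :
    Summable (appellTerm q y) := by
  obtain ⟨C, hC⟩ := exists_norm_inv_one_sub_mul_zpow_le hq h1 hy
  refine .of_norm_bounded
    ((summable_norm_thetaSeries hq h1 (mul_ne_zero hq hy)).mul_right C) fun i => ?_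
  rw [appellTerm_eq_thetaCoeff_mul hq, norm_mul]
  exact mul_le_mul_of_nonneg_left (hC i) (norm_nonneg _)

lemma hasSum_poleTerm_add_appellTerm (hq : q ≠ 0) (h1 : ‖q‖ < 1) (hy : y ≠ 0)
    (hqy : ∀ k : ℤ, y * q ^ k ≠ 1) :
    HasSum (fun i => thetaSeries q y * poleTerm q y i + eulerProd q ^ 3 * y * appellTerm q y i)
      (thetaSeries q y * (2 * ∑' p, oddGapTerm q p)) := by
  have fibre (i : ℤ) := (hasSum_gap_mul_thetaCoeff hq h1 (mul_ne_zero hy (zpow_ne_zero i hq))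
    (hqy i)).mul_left (thetaCoeff q i * y ^ i)
  have sum := ((hasSum_thetaCoeff_mul_gap hq h1 hy).prod_fiberwise fibre).neg
  rw [← mul_neg, neg_neg] at sum
  refine sum.congr_fun fun i => ?_
  rw [poleTerm_eq_neg_div_sq hq hy (hqy i), appellTerm_eq_thetaCoeff_mul hq,
    thetaSeries_eq_thetaCoeff_mul hq hy i, mul_zpow]
  ring

lemma hasSum_poleTerm (hq : q ≠ 0) (h1 : ‖q‖ < 1) (hy : y ≠ 0) (hqy : ∀ k : ℤ, y * q ^ k ≠ 1) :
    HasSum (poleTerm q y) (2 * ∑' p, oddGapTerm q p -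
      eulerProd q ^ 3 * (y * ∑' l, appellTerm q y l) / thetaSeries q y) := by
  have theta_ne_zero : thetaSeries q y ≠ 0 := by
    rw [thetaSeries_eq_tprod hq h1 hy]
    exact tprod_jacobiFactor_ne_zero h1 hy hqy
  have appell := (summable_appellTerm hq h1 hy).hasSum.mul_left (eulerProd q ^ 3 * y)
  have pole := ((hasSum_poleTerm_add_appellTerm hq h1 hy hqy).sub appell).congr_fun
    (g := fun i => thetaSeries q y * poleTerm q y i) fun i => by ring
  rw [mul_assoc (eulerProd q ^ 3), ← mul_div_cancel₀ (eulerProd q ^ 3 * _) theta_ne_zero,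
    ← mul_sub] at pole
  exact (hasSum_mul_left_iff theta_ne_zero).1 pole

end TripleSum

/-! ### Specialisation to the upper half-plane -/

section Complex

open Complex HodgeElliptic
open UpperHalfPlane hiding I

lemma q_ne_zero (τ : ℍ) : q τ ≠ 0 := exp_ne_zero _

lemma norm_q_lt_one (τ : ℍ) : ‖q τ‖ < 1 := UpperHalfPlane.norm_exp_two_pi_I_lt_one τ

lemma y_ne_zero (z : ℂ) : y z ≠ 0 := exp_ne_zero _

lemma y_mul_q_zpow_ne_one {τ : ℍ} {z : ℂ} (hz : ∀ m n : ℤ, z ≠ (m : ℂ) + (n : ℂ) * (τ : ℂ))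
    (k : ℤ) : y z * q τ ^ k ≠ 1 := by
  intro h
  rw [y, q, ← exp_int_mul, ← exp_add, exp_eq_one_iff] at h
  obtain ⟨n, hn⟩ := h
  refine hz n (-k) (mul_left_cancel₀ two_pi_I_ne_zero ?_)
  push_cast
  linear_combination hn

lemma exp_neg_mul_y (z : ℂ) : cexp (-(Real.pi * I * z)) * y z = cexp (Real.pi * I * z) := by
  rw [y, ← exp_add]
  ring_nf

lemma sTerm_one (τ : ℍ) (z : ℂ) : sTerm 1 τ z = poleTerm (q τ) (y z) := by
  funext i
  rw [sTerm, poleTerm, sub_self, zero_sub]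

lemma eta_pow_three (τ : ℍ) :
    ModularForm.eta (τ : ℂ) ^ 3 =
      cexp (2 * Real.pi * I * (τ : ℂ) / 8) * eulerProd (q τ) ^ 3 := by
  have nome : Function.Periodic.qParam 24 (τ : ℂ) ^ 3 = cexp (2 * Real.pi * I * (τ : ℂ) / 8) := by
    rw [Function.Periodic.qParam, ← exp_nat_mul]
    congr 1
    push_cast
    ring
  have product : ∏' n, (1 - ModularForm.eta_q n (τ : ℂ)) = eulerProd (q τ) :=
    tprod_congr fun n => by rw [ModularForm.eta_q_eq_pow, q]
  rw [ModularForm.eta, mul_pow, nome, product]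

lemma theta1_ne_zero_iff {τ : ℍ} {z : ℂ} :
    theta1 τ z ≠ 0 ↔ ∏' n, jacobiFactor (q τ) (y z) n ≠ 0 := by
  simp [theta1, exp_ne_zero, jacobiFactor, thetaFactor]

lemma theta1_div_eta_pow_three (τ : ℍ) (z : ℂ) :
    theta1 τ z / ModularForm.eta (τ : ℂ) ^ 3 = I * cexp (-(Real.pi * I * z)) *
      ((∏' n, jacobiFactor (q τ) (y z) n) / eulerProd (q τ) ^ 3) := by
  have := exp_ne_zero (2 * Real.pi * I * (τ : ℂ) / 8)
  have : eulerProd (q τ) ≠ 0 := eulerProd_ne_zero (norm_q_lt_one τ)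
  have theta : theta1 τ z = I * cexp (2 * Real.pi * I * (τ : ℂ) / 8) *
    cexp (-(Real.pi * I * z)) * ∏' n, jacobiFactor (q τ) (y z) n := rfl
  rw [theta, eta_pow_three]
  field_simp

lemma theta1_mul_mu {τ : ℍ} {z : ℂ} (h : theta1 τ z ≠ 0) :
    theta1 τ z * mu τ z = -I * cexp (Real.pi * I * z) * ∑' l, appellTerm (q τ) (y z) l := by
  rw [mu, ← mul_assoc, mul_div_cancel₀ _ h]
  rfl

end Complex

end AppellLerch

end

open AppellLerch

theorem mainTheorem7_general {K : Type*} [NormedField K] [CompleteSpace K] {q y : K}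
    (hq : q ≠ 0) (h1 : ‖q‖ < 1) (hy : y ≠ 0) (hqy : ∀ k : ℤ, y * q ^ k ≠ 1) :
    Multipliable (jacobiFactor q y) ∧
    ∏' n, jacobiFactor q y n ≠ 0 ∧
    Summable (poleTerm q y) ∧
    Summable (appellTerm q y) ∧
    Summable (oddGapTerm q) ∧
    (∏' n, jacobiFactor q y n) / eulerProd q ^ 3 * ∑' i, poleTerm q y i =
      (∏' n, jacobiFactor q y n) / eulerProd q ^ 3 * (2 * ∑' p, oddGapTerm q p) -
        y * ∑' l, appellTerm q y l := by
  have theta_ne_zero := tprod_jacobiFactor_ne_zero h1 hy hqy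
  have pole := hasSum_poleTerm hq h1 hy hqy
  refine ⟨multipliable_jacobiFactor h1 y, theta_ne_zero, pole.summable,
    summable_appellTerm hq h1 hy, (summable_norm_oddGapTerm h1).of_norm, ?_⟩
  have := eulerProd_ne_zero h1
  rw [pole.tsum_eq, thetaSeries_eq_tprod hq h1 hy]
  field_simp

theorem mainTheorem7 (τ : UpperHalfPlane) (z : ℂ)
    (hz : ∀ m n : ℤ, z ≠ (m : ℂ) + (n : ℂ) * (τ : ℂ)) :
    Multipliable (HodgeElliptic.thetaFactor τ z) ∧
    HodgeElliptic.theta1 τ z ≠ 0 ∧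
    Summable (HodgeElliptic.sTerm 1 τ z) ∧
    Summable (HodgeElliptic.appellLerchTerm τ z) ∧
    Summable (HodgeElliptic.f22Term τ) ∧
    HodgeElliptic.s 1 τ z =
      HodgeElliptic.theta1 τ z / ModularForm.eta (τ : ℂ) ^ 3 * (2 * HodgeElliptic.F22 τ) +
        HodgeElliptic.theta1 τ z * HodgeElliptic.mu τ z := by
  obtain ⟨multipliable, product_ne_zero, pole, appell, gaps, identity⟩ := mainTheorem7_general
    (q_ne_zero τ) (norm_q_lt_one τ) (y_ne_zero z) (y_mul_q_zpow_ne_one hz)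
  have theta_ne_zero := theta1_ne_zero_iff.2 product_ne_zero
  have F22_eq : HodgeElliptic.F22 τ = ∑' p, oddGapTerm (HodgeElliptic.q τ) p := rfl
  refine ⟨multipliable, theta_ne_zero, sTerm_one τ z ▸ pole, appell, gaps, ?_⟩
  rw [HodgeElliptic.s, sTerm_one, theta1_div_eta_pow_three, theta1_mul_mu theta_ne_zero, F22_eq,
    ← exp_neg_mul_y]
  linear_combination Complex.I * Complex.exp (-(Real.pi * Complex.I * z)) * identity
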